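/- Let $n\ge 1$ and let $a_0,\dots,a_n$ be positive integers. On $\mathbb C^{n+1}$ with coordinates $z_j=x_j+iy_j$ let $$B=\Big\{z\in\mathbb C^{n+1} : \sum_{j=0}^n|z_j|^2=1,\ \sum_{j=0}^n z_j^{a_j}=0\Big\},\qquad \alpha=\frac14\sum_{j=0}^n a_j\,(x_j\,dy_j-y_j\,dx_j).$$ Then $B$ is a smooth embedded submanifold of dimension $2n-1$, $\alpha$ restricts to a contact form on $B$, and the Reeb vector field of $(B,\alpha)$ (defined by $i_Z\alpha=1$, $i_Zd\alpha=0$) is the restriction to $B$ of $$Z=4i\sum_{j=0}^n\frac1{a_j}\Big(z_j\frac{\partial}{\partial z_j}-\bar z_j\frac{\partial}{\partial\bar z_j}\Big).$$ For a smooth function $f$ on $B$ let $Y_f=fZ+\hat Y_f$ be its contact Hamiltonian vector field, where $\hat Y_f$ is the vector field on $B$ with $\alpha(\hat Y_f)=0$ and $-i_{\hat Y_f}d\alpha=df-Z(f)\alpha$, and let $$[f,g]_B=d\alpha(Y_f,Y_g)+fZ(g)-gZ(f)$$ be the Jacobi bracket. Call finitely many functions on $B$ independent if their differentials are linearly independent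 at each point of an open dense subset of $B$. A set of functions on a $(2N+1)$-dimensional $(M,\alpha)$ is a complete noncommutative set of integrals of the Reeb flow if for some $0\le r\le N$ all its elements are smooth integrals of the Reeb flow ($Z(f)=0$) and it contains $2N-r$ independent functions $g_1,\dots,g_{2N-r}$ with $[g_i,g_j]=0$ for all $i\le 2N-r$ and $j\le r$. The functions $f_j=|z_j|^2$ and $[f_j,f_k]_B$, $j,k=0,\dots,n$, form a complete noncommutative set of integrals of the Reeb flow on $(B,\alpha)$, with $N=n-1$ and $r=0$. In particular, there are $2n-2$ independent functions on $B$ among them. -/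

import Mathlib

open scoped ContDiff

noncomputable section

/-!
# Contact geometry of regular level sets

A submanifold `M` of a finite-dimensional real vector space `E` is given as the zero set of a
smooth map `Φ : E → W` which is a submersion along `M`. Functions, vector fields and the contact
form on `M` are written on `E`, but every notion below depends only on their restriction to `M`
(to tangent vectors of `M`).
-/

namespace ContactLevelSet

section General

variable {E W : Type*} [NormedAddCommGroup E] [NormedSpace ℝ E]
  [NormedAddCommGroup W] [NormedSpace ℝ W]

/-- The level set `M = {z | Φ z = 0}`. -/
def carrier (Φ : E → W) : Set E := {z | Φ z = 0}

/-- `Φ` is smooth and a submersion at each point of `M`: then `M` is an embedded submanifold. -/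
def IsRegular (Φ : E → W) : Prop :=
  ContDiff ℝ ∞ Φ ∧ ∀ z ∈ carrier Φ, Function.Surjective (fderiv ℝ Φ z)

/-- The tangent space `T_z M = ker (dΦ_z)`. -/
def tangent (Φ : E → W) (z : E) : Submodule ℝ E :=
  LinearMap.ker (fderiv ℝ Φ z : E →ₗ[ℝ] W)

/-- `f` is a smooth function on `M`: near each point of `M` it is the restriction of a smooth
function defined on an open subset of `E`. -/
def IsSmoothFunction (Φ : E → W) (f : E → ℝ) : Prop :=
  ∀ z ∈ carrier Φ, ∃ U : Set E, IsOpen U ∧ z ∈ U ∧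
    ∃ g : E → ℝ, ContDiffOn ℝ ∞ g U ∧ Set.EqOn f g (carrier Φ ∩ U)

/-- The differential at `z ∈ M` of a function on `M`, a linear form on `T_z M`. The derivative of
`f` within `M` is determined on the tangent vectors of `M`, and only these are kept. -/
def differential (Φ : E → W) (f : E → ℝ) (z : E) : Module.Dual ℝ (tangent Φ z) :=
  (fderivWithin ℝ f (carrier Φ) z : E →ₗ[ℝ] ℝ).domRestrict (tangent Φ z)

/-- The exterior derivative `dα` of a 1-form `α`, as a function of two vectors. -/
def dForm (α : E → E →L[ℝ] ℝ) (z u v : E) : ℝ :=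
  extDeriv (fun w => ContinuousAlternatingMap.ofSubsingleton ℝ E ℝ (0 : Fin 1) (α w)) z ![u, v]

/-- The (pull-back of the) form `α` is a contact form on `M`, and `dim M = 2 * N + 1`: in this
dimension `α ∧ (dα)^N ≠ 0` at `z` means that `α_z ≠ 0` on `T_z M` and that `dα_z` is nondegenerate
on `ker α_z ⊆ T_z M`. -/
structure IsContactForm (Φ : E → W) (α : E → E →L[ℝ] ℝ) (N : ℕ) : Prop where
  regular : IsRegular Φ
  smooth : ContDiff ℝ ∞ α
  finrank_tangent : ∀ z ∈ carrier Φ, Module.finrank ℝ (tangent Φ z) = 2 * N + 1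
  ne_zero : ∀ z ∈ carrier Φ, ∃ v ∈ tangent Φ z, α z v ≠ 0
  nondegenerate : ∀ z ∈ carrier Φ, ∀ u ∈ tangent Φ z, α z u = 0 →
    (∀ v ∈ tangent Φ z, α z v = 0 → dForm α z u v = 0) → u = 0

/-- `v` is the value at `z` of the Reeb field of `(M, α)`: `i_v α = 1`, `i_v dα = 0` on `T_z M`. -/
def IsReebAt (Φ : E → W) (α : E → E →L[ℝ] ℝ) (z v : E) : Prop :=
  v ∈ tangent Φ z ∧ α z v = 1 ∧ ∀ w ∈ tangent Φ z, dForm α z v w = 0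

/-- The Reeb vector field `Z` of `(M, α)`. -/
def reeb (Φ : E → W) (α : E → E →L[ℝ] ℝ) (z : E) : E :=
  Classical.epsilon (IsReebAt Φ α z)

open Classical in
/-- The derivative of `f` at `z` along a vector `v` tangent to `M`. -/
def deriveAlong (Φ : E → W) (f : E → ℝ) (z v : E) : ℝ :=
  if h : v ∈ tangent Φ z then differential Φ f z ⟨v, h⟩ else 0

/-- `v` is the value at `z` of the horizontal part of the contact Hamiltonian field of `f`:
`v` is tangent to `M`, `α(v) = 0` and `-i_v dα = df - Z(f) α` on `T_z M`. -/
def IsHorizontalHamiltonianAt (Φ : E → W) (α : E → E →L[ℝ] ℝ) (f : E → ℝ) (z v : E) : Prop :=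
  v ∈ tangent Φ z ∧ α z v = 0 ∧ ∀ w ∈ tangent Φ z,
    -dForm α z v w = deriveAlong Φ f z w - deriveAlong Φ f z (reeb Φ α z) * α z w

/-- The contact Hamiltonian vector field `Y_f = f Z + Ŷ_f` of `f` on `(M, α)`. -/
def contactHamiltonian (Φ : E → W) (α : E → E →L[ℝ] ℝ) (f : E → ℝ) (z : E) : E :=
  f z • reeb Φ α z + Classical.epsilon (IsHorizontalHamiltonianAt Φ α f z)

/-- The Jacobi bracket `[f, g] = dα(Y_f, Y_g) + f Z(g) - g Z(f)` of functions on `(M, α)`. -/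
def jacobiBracket (Φ : E → W) (α : E → E →L[ℝ] ℝ) (f g : E → ℝ) (z : E) : ℝ :=
  dForm α z (contactHamiltonian Φ α f z) (contactHamiltonian Φ α g z)
    + f z * deriveAlong Φ g z (reeb Φ α z) - g z * deriveAlong Φ f z (reeb Φ α z)

/-- `f` is a smooth function on `M` with `[1, f] = Z(f) = 0`, an integral of the Reeb flow. -/
def IsReebIntegral (Φ : E → W) (α : E → E →L[ℝ] ℝ) (f : E → ℝ) : Prop :=
  IsSmoothFunction Φ f ∧ ∀ z ∈ carrier Φ, deriveAlong Φ f z (reeb Φ α z) = 0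

/-- The functions `g i` are independent on `M`: their differentials are linearly independent at
each point of an open dense subset of `M`. -/
def AreIndependent (Φ : E → W) {ι : Type*} (g : ι → E → ℝ) : Prop :=
  ∃ U : Set (carrier Φ), IsOpen U ∧ Dense U ∧
    ∀ z ∈ U, LinearIndependent ℝ (fun i => differential Φ (g i) (z : E))

/-- `S` is a complete noncommutative set of integrals of the Reeb flow of the
`(2 * N + 1)`-dimensional `(M, α)`: it consists of integrals, and it contains `2 * N - r`
independent functions the first `r` of which commute with all of them. The regular compact
connected level sets are then tori of dimension `r + 1`. -/
def IsCompleteNoncommutative (Φ : E → W) (α : E → E →L[ℝ] ℝ) (N r : ℕ)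
    (S : Set (E → ℝ)) : Prop :=
  r ≤ N ∧ (∀ f ∈ S, IsReebIntegral Φ α f) ∧
    ∃ g : Fin (2 * N - r) → E → ℝ, (∀ i, g i ∈ S) ∧ AreIndependent Φ g ∧
      ∀ i j : Fin (2 * N - r), (j : ℕ) < r → ∀ z ∈ carrier Φ, jacobiBracket Φ α (g i) (g j) z = 0

end General

end ContactLevelSet

namespace Brieskorn

/-- The defining map `z ↦ (∑ |z_j|² - 1, ∑ z_j ^ a_j)`; its zero set is the Brieskorn manifold. -/
def definingMap {n : ℕ} (a : Fin (n + 1) → ℕ) (z : Fin (n + 1) → ℂ) : ℝ × ℂ :=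
  (∑ j, ‖z j‖ ^ 2 - 1, ∑ j, z j ^ a j)

/-- The 1-form `α = (1/4) ∑ a_j (x_j dy_j - y_j dx_j)`, where `z_j = x_j + i y_j`. -/
def contactForm {n : ℕ} (a : Fin (n + 1) → ℕ) (z : Fin (n + 1) → ℂ) :
    (Fin (n + 1) → ℂ) →L[ℝ] ℝ :=
  (1 / 4 : ℝ) • ∑ j, (a j : ℝ) •
    ((z j).re • (Complex.imCLM.comp (ContinuousLinearMap.proj (R := ℝ) j))
      - (z j).im • (Complex.reCLM.comp (ContinuousLinearMap.proj (R := ℝ) j)))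

/-- The vector field `4 i ∑ (1 / a_j) (z_j ∂/∂z_j - conj z_j ∂/∂(conj z_j))`. -/
def reebField {n : ℕ} (a : Fin (n + 1) → ℕ) (z : Fin (n + 1) → ℂ) : Fin (n + 1) → ℂ :=
  fun j => 4 * Complex.I / (a j : ℂ) * z j

/-- The function `f_j = |z_j|²`. -/
def coordIntegral {n : ℕ} (j : Fin (n + 1)) (z : Fin (n + 1) → ℂ) : ℝ := ‖z j‖ ^ 2

/-- The Jacobi bracket `[f_j, f_k]_B` on the Brieskorn manifold `(B, α)`. -/
def bracketIntegral {n : ℕ} (a : Fin (n + 1) → ℕ) (j k : Fin (n + 1)) :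
    (Fin (n + 1) → ℂ) → ℝ :=
  ContactLevelSet.jacobiBracket (definingMap a) (contactForm a) (coordIntegral j) (coordIntegral k)

/-- The set of all functions `f_j` and `[f_j, f_k]_B`. -/
def integrals {n : ℕ} (a : Fin (n + 1) → ℕ) : Set ((Fin (n + 1) → ℂ) → ℝ) :=
  {f | (∃ j, f = coordIntegral j) ∨ ∃ j k, f = bracketIntegral a j k}

end Brieskorn

end

noncomputable section

namespace ContactLevelSet

open Topology Filter

/-! ### Calculus on a regular level set -/

section General

variable {E W : Type*} [NormedAddCommGroup E] [NormedSpace ℝ E]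
  [NormedAddCommGroup W] [NormedSpace ℝ W]

/-! Everything is computed with the Hermitian form `H(u,v) = ∑ a_j conj(u_j) v_j`: one has `α_z =
(1/4) Im H(z,·)` and `dα = (1/2) Im H`. With `w = (z_j / a_j)` and `g` the conjugate power gradient,
tangency of `v` means `Re H(w,v) = 0` and `H(g,v) = 0`. On `B`, `H(w,z) = 1` and `H(g,w) = 0`, so
the Reeb field is `4i w`, and nondegeneracy follows by projecting along `z` and `g`
(`eq_zero_of_dForm_eq_zero`).

The Hamiltonian field of `f_j` is a rotation of the `j`-th coordinate corrected by multiples of `g`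
and of the Reeb field. Hence `[f_j,f_k] = 8 Im(conj(z_k^{a_k}) z_j^{a_j}) / H(g,g)` on `B`
(`bracketIntegral_eqOn`).

For independence, take `f_1, …, f_n` and `[f_0,f_k]` with `1 ≤ k ≤ n-2`, and write a tangent vector
at a point without zero coordinates as `v_j = (ζ_j / a_j) z_j`. The `f_j` and the sphere equation
force every `ζ_j` to be imaginary; the brackets force `ζ_k = ζ_0` for `k ≤ n-2`. What remains of `∑
ζ_j z_j^{a_j} = 0` is a real relation between the last two powers, which is trivial when these are
real-linearly independent. So the common kernel is the Reeb line (`mem_span_reebField`), and `2n-2`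
forms on a space of dimension `2n-1` are independent. The genericity conditions are open and dense
(`dense_coord_ne_zero`, `dense_mixedPower_ne_zero`). -/

theorem mem_tangent_iff {Φ : E → W} {z v : E} : v ∈ tangent Φ z ↔ fderiv ℝ Φ z v = 0 := by
  simp [tangent]

theorem IsRegular.hasStrictFDerivAt {Φ : E → W} (hΦ : IsRegular Φ) (z : E) :
    HasStrictFDerivAt Φ (fderiv ℝ Φ z) z :=
  hΦ.1.contDiffAt.hasStrictFDerivAt (by simp)

/-- Vectors in the kernel of `dΦ` are tangent to the level set. -/
theorem IsRegular.mem_tangentConeAt [CompleteSpace E] [FiniteDimensional ℝ W] {Φ : E → W}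
    (hΦ : IsRegular Φ) {z v : E} (hz : z ∈ carrier Φ) (hv : v ∈ tangent Φ z) :
    v ∈ tangentConeAt ℝ (carrier Φ) z := by
  have hs := hΦ.hasStrictFDerivAt z
  have hr : (fderiv ℝ Φ z).range = ⊤ := LinearMap.range_eq_top.2 (hΦ.2 z hz)
  let v' : (fderiv ℝ Φ z).ker := ⟨v, mem_tangent_iff.1 hv⟩
  let γ : ℝ → E := fun t => hs.implicitFunction Φ (fderiv ℝ Φ z) hr (Φ z) (t • v')
  have hline : HasDerivAt (fun t : ℝ => t • v') v' 0 := by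
    simpa using (hasDerivAt_id (0 : ℝ)).smul_const v'
  have hγ : HasDerivAt γ v 0 := by
    have h := (hs.to_implicitFunction hr).hasFDerivAt
    rw [← zero_smul ℝ v'] at h
    exact h.comp_hasDerivAt (0 : ℝ) hline
  have hγ0 : γ 0 = z := by simp [γ]
  have hmem : ∀ᶠ t in 𝓝 (0 : ℝ), γ t ∈ carrier Φ := by
    have ht : Tendsto (fun t : ℝ => (Φ z, t • v')) (𝓝 0) (𝓝 (Φ z, 0)) := by
      have h0 : Tendsto (fun t : ℝ => t • v') (𝓝 0) (𝓝 0) := by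
        simpa using hline.continuousAt.tendsto
      exact tendsto_const_nhds.prodMk_nhds h0
    filter_upwards [ht.eventually (hs.map_implicitFunction_eq hr)] with t ht
    exact ht.trans hz
  have hw := hγ.hasFDerivAt.hasFDerivWithinAt (s := {t | γ t ∈ carrier Φ})
  have h1 : (1 : ℝ) ∈ tangentConeAt ℝ {t | γ t ∈ carrier Φ} 0 := by
    rw [tangentConeAt_of_mem_nhds hmem]; trivial
  have h2 := hw.mapsTo_tangent_cone h1
  rw [hγ0] at h2
  have h3 : γ '' {t | γ t ∈ carrier Φ} ⊆ carrier Φ := Set.image_subset_iff.2 fun t ht => ht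
  exact tangentConeAt_mono h3 (by simpa using h2)

/-- Derivatives within a set are unique only along its tangent cone, and the cone of the level set
contains `ker dΦ`. -/
theorem IsRegular.differential_apply [CompleteSpace E] [FiniteDimensional ℝ W] {Φ : E → W}
    (hΦ : IsRegular Φ) {z : E} (hz : z ∈ carrier Φ) {f : E → ℝ} {f' : E →L[ℝ] ℝ}
    (hf : HasFDerivAt f f' z) (v : tangent Φ z) : differential Φ f z v = f' v := by
  have h1 := hf.hasFDerivWithinAt (s := carrier Φ)
  exact h1.differentiableWithinAt.hasFDerivWithinAt.unique_on h1 (hΦ.mem_tangentConeAt hz v.2)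

theorem differential_congr {Φ : E → W} {f g : E → ℝ} (h : Set.EqOn f g (carrier Φ)) {z : E}
    (hz : z ∈ carrier Φ) : differential Φ f z = differential Φ g z := by
  rw [differential, differential, fderivWithin_congr h (h hz)]

/-- Near a point of the level set where a function vanishes and has a nonzero derivative along
some tangent vector, there are points of the level set where it does not vanish. -/
theorem IsRegular.mem_closure_ne_zero [CompleteSpace E] [CompleteSpace W] {Φ : E → W}
    (hΦ : IsRegular Φ) (z : carrier Φ) {h : E → ℝ} {h' : E →L[ℝ] ℝ}
    (hh : HasStrictFDerivAt h h' z) {v : E} (hv : v ∈ tangent Φ (z : E)) (hne : h' v ≠ 0) :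
    z ∈ closure {x : carrier Φ | h x ≠ 0} := by
  have hs := (hΦ.hasStrictFDerivAt (z : E)).prodMk hh
  have hr : ((fderiv ℝ Φ (z : E)).prod h').range = ⊤ := by
    refine LinearMap.range_eq_top.2 fun ⟨w, t⟩ => ?_
    obtain ⟨u, hu⟩ := hΦ.2 z z.2 w
    -- Moving along `v` changes `h'` freely without affecting `dΦ`, so `(Φ, h)` is a submersion and
    -- hence locally open.
    refine ⟨u + ((t - h' u) / h' v) • v, ?_⟩
    have := mem_tangent_iff.1 hv
    simp [hu, this, hne]
  have hmap := hs.map_nhds_eq_of_surj hr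
  rw [mem_closure_iff_nhds]
  intro t ht
  obtain ⟨u, hu, hut⟩ := mem_nhds_subtype _ _ _ |>.1 ht
  have h1 := image_mem_map (m := fun x => (Φ x, h x)) hu
  rw [hmap, nhds_prod_eq, mem_prod_iff] at h1
  obtain ⟨A, hA, B, hB, hAB⟩ := h1
  have hBn : ∃ s ∈ B, s ≠ 0 := by
    have : ∃ᶠ s in 𝓝 (h z), s ≠ 0 := by
      by_cases h0 : h z = 0
      · rw [h0]
        exact (Filter.eventually_of_mem self_mem_nhdsWithin fun x hx => hx :
          ∀ᶠ s in 𝓝[≠] (0 : ℝ), s ≠ 0).frequently.filter_mono nhdsWithin_le_nhds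
      · exact (isOpen_ne.eventually_mem h0).frequently
    obtain ⟨s, h1, h2⟩ := (this.and_eventually hB).exists
    exact ⟨s, h2, h1⟩
  obtain ⟨s, hsB, hs0⟩ := hBn
  obtain ⟨x, hxu, hx⟩ := hAB (Set.mk_mem_prod (mem_of_mem_nhds hA) hsB)
  have hx1 : Φ x = Φ z := congrArg Prod.fst hx
  have hx2 : h x = s := congrArg Prod.snd hx
  refine ⟨⟨x, hx1.trans z.2⟩, hut hxu, ?_⟩
  simpa [hx2] using hs0

theorem dForm_eq {α : E → E →L[ℝ] ℝ} {z : E} (hα : DifferentiableAt ℝ α z) (u v : E) :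
    dForm α z u v = fderiv ℝ α z u v - fderiv ℝ α z v u := by
  have h1 : DifferentiableAt ℝ
      (fun w => ContinuousAlternatingMap.ofSubsingleton ℝ E ℝ (0 : Fin 1) (α w)) z :=
    (ContinuousAlternatingMap.ofSubsingletonLIE (𝕜 := ℝ) (E := E) (F := ℝ)
      (0 : Fin 1)).toContinuousLinearEquiv.differentiableAt.comp z hα
  rw [dForm, extDeriv_apply h1]
  have h2 : ∀ x y : E, fderiv ℝ (fun w => α w x) z y = fderiv ℝ α z y x := fun x y => by
    rw [fderiv_clm_apply hα (differentiableAt_const x)]; simp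
  simp [Fin.sum_univ_two, Fin.removeNth, h2, sub_eq_add_neg]

end General

/-! ### Uniqueness of the Reeb and Hamiltonian fields -/

section Contact

variable {E W : Type*} [NormedAddCommGroup E] [NormedSpace ℝ E]
  [NormedAddCommGroup W] [NormedSpace ℝ W] {Φ : E → W} {α : E → E →L[ℝ] ℝ} {N : ℕ}

theorem IsContactForm.dForm_eq (h : IsContactForm Φ α N) (z u v : E) :
    dForm α z u v = fderiv ℝ α z u v - fderiv ℝ α z v u :=
  ContactLevelSet.dForm_eq (h.smooth.contDiffAt.differentiableAt (by simp)) u v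

/-- Nondegeneracy applied to the difference; this identifies the fields picked by
`Classical.epsilon` with explicit ones. -/
theorem IsContactForm.eq_of_forall (h : IsContactForm Φ α N) {z u v : E} (hz : z ∈ carrier Φ)
    (hu : u ∈ tangent Φ z) (hv : v ∈ tangent Φ z) (huv : α z u = α z v)
    (hd : ∀ w ∈ tangent Φ z, dForm α z u w = dForm α z v w) : u = v := by
  refine sub_eq_zero.1 (h.nondegenerate z hz _ (sub_mem hu hv) (by simp [huv]) fun w hw _ => ?_)
  have := hd w hw
  simp only [h.dForm_eq, map_sub, sub_apply] at this ⊢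
  linarith

theorem IsContactForm.reeb_eq (h : IsContactForm Φ α N) {z v : E} (hz : z ∈ carrier Φ)
    (hv : IsReebAt Φ α z v) : reeb Φ α z = v := by
  have h1 : IsReebAt Φ α z (reeb Φ α z) := Classical.epsilon_spec ⟨v, hv⟩
  exact h.eq_of_forall hz h1.1 hv.1 (h1.2.1.trans hv.2.1.symm)
    fun w hw => (h1.2.2 w hw).trans (hv.2.2 w hw).symm

theorem IsContactForm.contactHamiltonian_eq (h : IsContactForm Φ α N) {z v y : E} {f : E → ℝ}
    (hz : z ∈ carrier Φ) (hv : IsReebAt Φ α z v) (hy : IsHorizontalHamiltonianAt Φ α f z y) :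
    contactHamiltonian Φ α f z = f z • v + y := by
  have h1 : IsHorizontalHamiltonianAt Φ α f z
      (Classical.epsilon (IsHorizontalHamiltonianAt Φ α f z)) := Classical.epsilon_spec ⟨y, hy⟩
  rw [contactHamiltonian, h.reeb_eq hz hv]
  congr 1
  exact h.eq_of_forall hz h1.1 hy.1 (h1.2.1.trans hy.2.1.symm)
    fun w hw => neg_injective ((h1.2.2 w hw).trans (hy.2.2 w hw).symm)

/-- The Reeb components drop out of `dα(Y_f, Y_g)` because `i_Z dα = 0`, and the other two terms
vanish for integrals. -/
theorem IsContactForm.jacobiBracket_eq (h : IsContactForm Φ α N) {z v y y' : E} {f g : E → ℝ}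
    (hz : z ∈ carrier Φ) (hv : IsReebAt Φ α z v) (hy : IsHorizontalHamiltonianAt Φ α f z y)
    (hy' : IsHorizontalHamiltonianAt Φ α g z y') (hf : deriveAlong Φ f z v = 0)
    (hg : deriveAlong Φ g z v = 0) : jacobiBracket Φ α f g z = dForm α z y y' := by
  rw [jacobiBracket, h.contactHamiltonian_eq hz hv hy, h.contactHamiltonian_eq hz hv hy',
    h.reeb_eq hz hv, hf, hg]
  have h1 := hv.2.2 y hy.1
  have h2 := hv.2.2 y' hy'.1
  simp only [h.dForm_eq, map_add, map_smul, add_apply,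
    smul_apply, smul_eq_mul] at h1 h2 ⊢
  linear_combination f z * h2 - g z * h1

end Contact

/-- Linear forms are independent if their common kernel is as small as their number allows. -/
theorem linearIndependent_of_finrank_ker_pi_le {V ι : Type*} [AddCommGroup V] [Module ℝ V]
    [FiniteDimensional ℝ V] [Fintype ι] (L : ι → Module.Dual ℝ V)
    (h : Fintype.card ι + Module.finrank ℝ (LinearMap.pi L).ker ≤ Module.finrank ℝ V) :
    LinearIndependent ℝ L := by
  have h1 := LinearMap.finrank_range_add_finrank_ker (LinearMap.pi L)
  have h2 : (LinearMap.pi L).range = ⊤ := by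
    apply Submodule.eq_top_of_finrank_eq
    have := Submodule.finrank_le (LinearMap.pi L).range
    rw [Module.finrank_fintype_fun_eq_card] at *
    omega
  classical
  rw [Fintype.linearIndependent_iff]
  intro c hc i
  obtain ⟨v, hv⟩ := LinearMap.range_eq_top.1 h2 (Pi.single i 1)
  have h3 := congrArg (fun l : Module.Dual ℝ V => l v) hc
  have h4 : ∀ j, L j v = (Pi.single i 1 : ι → ℝ) j := fun j => by rw [← hv]; rfl
  simpa [h4, Pi.single_apply] using h3

end ContactLevelSet

end

noncomputable section

namespace Brieskorn

open ContactLevelSet ComplexConjugate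

/-! ### Contact geometry of the Brieskorn manifold through the weighted Hermitian form -/

variable {n : ℕ} {a : Fin (n + 1) → ℕ} {z : Fin (n + 1) → ℂ}

/-- The sesquilinear form `∑ a_j conj(u_j) v_j`. -/
def weightedForm (a : Fin (n + 1) → ℕ) :
    (Fin (n + 1) → ℂ) →ₗ⋆[ℂ] (Fin (n + 1) → ℂ) →ₗ[ℂ] ℂ :=
  LinearMap.mk₂'ₛₗ (starRingEnd ℂ) (RingHom.id ℂ) (fun u v => ∑ j, (a j : ℂ) * conj (u j) * v j)
    (fun u u' v => by simp [mul_add, add_mul, Finset.sum_add_distrib])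
    (fun c u v => by simp [Finset.mul_sum, mul_left_comm, mul_assoc])
    (fun u v v' => by simp [mul_add, Finset.sum_add_distrib])
    (fun c u v => by simp [Finset.mul_sum, mul_left_comm, mul_assoc])

theorem weightedForm_apply (u v : Fin (n + 1) → ℂ) :
    weightedForm a u v = ∑ j, (a j : ℂ) * conj (u j) * v j := rfl

theorem weightedForm_conj (u v : Fin (n + 1) → ℂ) :
    conj (weightedForm a u v) = weightedForm a v u := by
  simp only [weightedForm_apply, map_sum, map_mul, Complex.conj_conj, Complex.conj_natCast]
  exact Finset.sum_congr rfl fun j _ => by ring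

theorem weightedForm_self (u : Fin (n + 1) → ℂ) :
    weightedForm a u u = ((∑ j, (a j : ℝ) * ‖u j‖ ^ 2 : ℝ) : ℂ) := by
  rw [weightedForm_apply]
  push_cast
  refine Finset.sum_congr rfl fun j _ => ?_
  rw [mul_assoc, Complex.conj_mul']

theorem weightedForm_single (u : Fin (n + 1) → ℂ) (j : Fin (n + 1)) (c : ℂ) :
    weightedForm a u (Pi.single j c) = a j * conj (u j) * c := by
  simp [weightedForm_apply, Pi.single_apply]

/-- The vector `(z_j / a_j)_j`. -/
def weightedPoint (a : Fin (n + 1) → ℕ) (z : Fin (n + 1) → ℂ) : Fin (n + 1) → ℂ :=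
  fun j => z j / a j

/-- The gradient `(conj z_j ^ (a_j - 1))_j` of `∑ z_j ^ a_j` with respect to `weightedForm`. -/
def powerGradient (a : Fin (n + 1) → ℕ) (z : Fin (n + 1) → ℂ) : Fin (n + 1) → ℂ :=
  fun j => conj (z j ^ (a j - 1))

/-- The square norm of `powerGradient` with respect to `weightedForm`. -/
def gradientSq (a : Fin (n + 1) → ℕ) (z : Fin (n + 1) → ℂ) : ℝ :=
  ∑ j, (a j : ℝ) * ‖z j ^ (a j - 1)‖ ^ 2

theorem weightedForm_weightedPoint (ha : ∀ j, 0 < a j) (v : Fin (n + 1) → ℂ) :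
    weightedForm a (weightedPoint a z) v = ∑ j, conj (z j) * v j := by
  rw [weightedForm_apply]
  refine Finset.sum_congr rfl fun j _ => ?_
  have : (a j : ℂ) ≠ 0 := by exact_mod_cast (ha j).ne'
  simp only [weightedPoint, map_div₀, Complex.conj_natCast]
  field_simp

theorem weightedForm_powerGradient (v : Fin (n + 1) → ℂ) :
    weightedForm a (powerGradient a z) v = ∑ j, a j * z j ^ (a j - 1) * v j := by
  simp [weightedForm_apply, powerGradient]

theorem weightedForm_powerGradient_self :
    weightedForm a (powerGradient a z) (powerGradient a z) = gradientSq a z := by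
  rw [weightedForm_self]
  simp [powerGradient, gradientSq]

theorem mem_carrier_iff :
    z ∈ carrier (definingMap a) ↔ ∑ j, ‖z j‖ ^ 2 = 1 ∧ ∑ j, z j ^ a j = 0 := by
  simp [carrier, definingMap, sub_eq_zero]

theorem weightedForm_weightedPoint_self (ha : ∀ j, 0 < a j)
    (hz : z ∈ carrier (definingMap a)) : weightedForm a (weightedPoint a z) z = 1 := by
  rw [weightedForm_weightedPoint ha]
  simp only [Complex.conj_mul']
  exact_mod_cast (mem_carrier_iff.1 hz).1

/-- Euler's identity for the weighted homogeneous polynomial `∑ z_j^{a_j}`, which vanishes on `B`.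
-/
theorem weightedForm_powerGradient_weightedPoint (ha : ∀ j, 0 < a j)
    (hz : z ∈ carrier (definingMap a)) :
    weightedForm a (powerGradient a z) (weightedPoint a z) = 0 := by
  rw [weightedForm_powerGradient, ← (mem_carrier_iff.1 hz).2]
  refine Finset.sum_congr rfl fun j _ => ?_
  have : (a j : ℂ) ≠ 0 := by exact_mod_cast (ha j).ne'
  rw [← pow_sub_one_mul (ha j).ne' (z j), weightedPoint]
  field_simp

theorem weightedForm_weightedPoint_powerGradient (ha : ∀ j, 0 < a j)
    (hz : z ∈ carrier (definingMap a)) :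
    weightedForm a (weightedPoint a z) (powerGradient a z) = 0 := by
  rw [← weightedForm_conj, weightedForm_powerGradient_weightedPoint ha hz, map_zero]

theorem exists_ne_zero (hz : z ∈ carrier (definingMap a)) : ∃ j, z j ≠ 0 := by
  by_contra! h
  simpa [h] using (mem_carrier_iff.1 hz).1

theorem gradientSq_pos (ha : ∀ j, 0 < a j) (hz : z ∈ carrier (definingMap a)) :
    0 < gradientSq a z := by
  obtain ⟨j, hj⟩ := exists_ne_zero hz
  refine Finset.sum_pos' (fun i _ => by positivity) ⟨j, Finset.mem_univ j, ?_⟩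
  exact mul_pos (Nat.cast_pos.2 (ha j)) (pow_pos (norm_pos_iff.2 (pow_ne_zero _ hj)) 2)

theorem contDiff_definingMap : ContDiff ℝ ∞ (definingMap a) := by
  have h : ∀ j, ContDiff ℝ ∞ fun z : Fin (n + 1) → ℂ => z j := fun j => contDiff_apply ℝ ℂ j
  exact ((ContDiff.sum fun j _ => (h j).norm_sq ℝ).sub contDiff_const).prodMk
    (ContDiff.sum fun j _ => (h j).pow _)

theorem fderiv_definingMap (ha : ∀ j, 0 < a j) (v : Fin (n + 1) → ℂ) :
    fderiv ℝ (definingMap a) z v =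
      (2 * (weightedForm a (weightedPoint a z) v).re, weightedForm a (powerGradient a z) v) := by
  have h : ∀ j, HasFDerivAt (fun z : Fin (n + 1) → ℂ => z j)
      (ContinuousLinearMap.proj (R := ℝ) j) z := fun j => hasFDerivAt_apply j z
  have h1 := (HasFDerivAt.fun_sum fun j (_ : j ∈ Finset.univ) => (h j).norm_sq).sub_const 1
  have h2 := HasFDerivAt.fun_sum fun j (_ : j ∈ Finset.univ) => (h j).pow (a j)
  have h3 := h1.prodMk h2
  have h4 : fderiv ℝ (definingMap a) z = _ := h3.fderiv
  rw [h4, weightedForm_weightedPoint ha, weightedForm_powerGradient]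
  ext1
  · simp [Complex.inner, Finset.mul_sum, mul_comm]
    exact Finset.sum_congr rfl fun j _ => by ring
  · simp

theorem mem_tangent_iff (ha : ∀ j, 0 < a j) {v : Fin (n + 1) → ℂ} :
    v ∈ tangent (definingMap a) z ↔ (weightedForm a (weightedPoint a z) v).re = 0 ∧
      weightedForm a (powerGradient a z) v = 0 := by
  rw [ContactLevelSet.mem_tangent_iff, fderiv_definingMap ha]
  simp

theorem contactForm_apply (v : Fin (n + 1) → ℂ) :
    contactForm a z v = 1 / 4 * (weightedForm a z v).im := by
  simp only [contactForm, weightedForm_apply, Complex.im_sum, smul_apply, smul_eq_mul, sum_apply]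
  congr 1
  refine Finset.sum_congr rfl fun j _ => ?_
  simp
  ring

/-- `z ↦ α_z` as a continuous linear map. -/
def contactFormCLM (a : Fin (n + 1) → ℕ) :
    (Fin (n + 1) → ℂ) →L[ℝ] (Fin (n + 1) → ℂ) →L[ℝ] ℝ :=
  LinearMap.toContinuousLinearMap
    { toFun := contactForm a
      map_add' := fun u u' => by ext1 v; simp [contactForm_apply]; ring
      map_smul' := fun c u => by
        ext1 v
        rw [show c • u = (c : ℂ) • u by ext j; simp, smul_apply, contactForm_apply,
          contactForm_apply, map_smulₛₗ]
        simp
        ring }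

theorem contactFormCLM_apply : contactFormCLM a z = contactForm a z := rfl

theorem contDiff_contactForm : ContDiff ℝ ∞ (contactForm a) :=
  (contactFormCLM a).contDiff

theorem dForm_contactForm (u v : Fin (n + 1) → ℂ) :
    dForm (contactForm a) z u v = 1 / 2 * (weightedForm a u v).im := by
  have h : HasFDerivAt (contactForm a) (contactFormCLM a) z := (contactFormCLM a).hasFDerivAt
  rw [dForm_eq h.differentiableAt, h.fderiv, contactFormCLM_apply, contactFormCLM_apply,
    contactForm_apply, contactForm_apply, ← weightedForm_conj u v, Complex.conj_im]
  ring

/-- The projection onto the tangent space along `z` and the complex line of `powerGradient`. -/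
def tangentProj (a : Fin (n + 1) → ℕ) (z v : Fin (n + 1) → ℂ) : Fin (n + 1) → ℂ :=
  v - ((weightedForm a (weightedPoint a z) v).re : ℂ) • z
    - ((weightedForm a (powerGradient a z) v - (weightedForm a (weightedPoint a z) v).re *
        weightedForm a (powerGradient a z) z) / gradientSq a z) • powerGradient a z

theorem tangentProj_mem (ha : ∀ j, 0 < a j) (hz : z ∈ carrier (definingMap a))
    (v : Fin (n + 1) → ℂ) : tangentProj a z v ∈ tangent (definingMap a) z := by
  have hQ : (gradientSq a z : ℂ) ≠ 0 := by exact_mod_cast (gradientSq_pos ha hz).ne'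
  rw [mem_tangent_iff ha]
  constructor
  · simp [tangentProj, weightedForm_weightedPoint_self ha hz,
      weightedForm_weightedPoint_powerGradient ha hz]
  · simp only [tangentProj, map_sub, map_smul, weightedForm_powerGradient_self, smul_eq_mul]
    field_simp
    ring

theorem isRegular_definingMap (ha : ∀ j, 0 < a j) : ContactLevelSet.IsRegular (definingMap a) := by
  refine ⟨contDiff_definingMap, fun z hz ⟨s, c⟩ => ?_⟩
  have hQ : (gradientSq a z : ℂ) ≠ 0 := by exact_mod_cast (gradientSq_pos ha hz).ne'
  refine ⟨((s / 2 : ℝ) : ℂ) • z + ((c - (s / 2 : ℝ) * weightedForm a (powerGradient a z) z) /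
    gradientSq a z) • powerGradient a z, ?_⟩
  rw [fderiv_definingMap ha]
  ext1
  · simp [weightedForm_weightedPoint_self ha hz, weightedForm_weightedPoint_powerGradient ha hz]
    ring
  · simp only [map_add, map_smul, weightedForm_powerGradient_self, smul_eq_mul]
    field_simp
    ring

theorem finrank_tangent (ha : ∀ j, 0 < a j) (hz : z ∈ carrier (definingMap a)) :
    Module.finrank ℝ (tangent (definingMap a) z) + 3 = 2 * (n + 1) := by
  have h1 := LinearMap.finrank_range_add_finrank_ker
    (fderiv ℝ (definingMap a) z : (Fin (n + 1) → ℂ) →ₗ[ℝ] ℝ × ℂ)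
  have h2 : Module.finrank ℝ (Fin (n + 1) → ℂ) = (n + 1) * 2 := by
    simp [Module.finrank_pi_fintype, Complex.finrank_real_complex]
  have h3 : Module.finrank ℝ (ℝ × ℂ) = 3 := by
    simp [Complex.finrank_real_complex]
  rw [LinearMap.range_eq_top.2 ((isRegular_definingMap ha).2 z hz), finrank_top, h2, h3] at h1
  rw [tangent]
  omega

theorem reebField_eq : reebField a z = (4 * Complex.I) • weightedPoint a z := by
  ext j
  simp only [reebField, weightedPoint, Pi.smul_apply, smul_eq_mul]
  ring

/-- The contraction of `dα` with `4i w` is `-2 Re H(w,·)`, which is zero on tangent vectors by the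
sphere equation. -/
theorem isReebAt_reebField (ha : ∀ j, 0 < a j) (hz : z ∈ carrier (definingMap a)) :
    IsReebAt (definingMap a) (contactForm a) z (reebField a z) := by
  refine ⟨(mem_tangent_iff ha).2 ⟨?_, ?_⟩, ?_, fun w hw => ?_⟩
  · rw [reebField_eq, map_smul, weightedForm_self, smul_eq_mul,
      Complex.re_mul_ofReal]
    simp
  · rw [reebField_eq, map_smul, weightedForm_powerGradient_weightedPoint ha hz, smul_zero]
  · rw [contactForm_apply, reebField_eq, map_smul, ← weightedForm_conj,
      weightedForm_weightedPoint_self ha hz]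
    simp
  · rw [dForm_contactForm, reebField_eq, map_smulₛₗ]
    simp [((mem_tangent_iff ha).1 hw).1]

/-- The two directions lost by projecting to the tangent space cost nothing: `H(u,g) = 0` since `u`
is tangent, and `Im H(u,z) = 0` since `α(u) = 0`. So `Im H(u,·)` vanishes on the whole space. -/
theorem eq_zero_of_dForm_eq_zero (ha : ∀ j, 0 < a j) (hz : z ∈ carrier (definingMap a))
    {u : Fin (n + 1) → ℂ} (hu : u ∈ tangent (definingMap a) z) (hα : contactForm a z u = 0)
    (h : ∀ v ∈ tangent (definingMap a) z, contactForm a z v = 0 →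
      dForm (contactForm a) z u v = 0) : u = 0 := by
  obtain ⟨hZt, hZ1, hZd⟩ := isReebAt_reebField ha hz
  have hu' := (mem_tangent_iff ha).1 hu
  have hskew : ∀ v w : Fin (n + 1) → ℂ, (weightedForm a v w).im = -(weightedForm a w v).im :=
    fun v w => by rw [← weightedForm_conj w v, Complex.conj_im]
  have h1 : ∀ v ∈ tangent (definingMap a) z, (weightedForm a u v).im = 0 := by
    intro v hv
    -- Removing the Reeb component puts `v` in `ker α` without changing its pairing with `u`.
    have h2 := h (v - contactForm a z v • reebField a z)
      (sub_mem hv (Submodule.smul_mem _ _ hZt)) (by simp [hZ1])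
    have h3 := hZd u hu
    have h4 : contactForm a z v • reebField a z = (contactForm a z v : ℂ) • reebField a z := by
      ext j; simp
    rw [dForm_contactForm] at h2 h3
    rw [h4, map_sub, map_smul] at h2
    have h5 := hskew u (reebField a z)
    have h6 : (weightedForm a (reebField a z) u).im = 0 := by linarith
    rw [h6] at h5
    simp [h5] at h2
    exact h2
  have h2 : ∀ v, (weightedForm a u v).im = 0 := by
    intro v
    have h3 := h1 _ (tangentProj_mem ha hz v)
    have h4 : weightedForm a u (powerGradient a z) = 0 := by
      rw [← weightedForm_conj, hu'.2, map_zero]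
    have h5 : (weightedForm a u z).im = 0 := by
      rw [contactForm_apply] at hα
      rw [hskew]; linarith
    simpa [tangentProj, h4, h5] using h3
  -- `Im H(u, iu) = H(u,u)`, which is positive definite.
  have h3 := h2 (Complex.I • u)
  rw [map_smul, weightedForm_self, smul_eq_mul, Complex.I_mul_im, Complex.ofReal_re,
    Finset.sum_eq_zero_iff_of_nonneg fun j _ => by positivity] at h3
  ext j
  have := h3 j (Finset.mem_univ j)
  simpa [(ha j).ne'] using this

theorem isContactForm_contactForm (hn : 1 ≤ n) (ha : ∀ j, 0 < a j) :
    IsContactForm (definingMap a) (contactForm a) (n - 1) where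
  regular := isRegular_definingMap ha
  smooth := contDiff_contactForm
  finrank_tangent z hz := by
    have := Brieskorn.finrank_tangent ha hz
    omega
  ne_zero z hz := by
    obtain ⟨h1, h2, -⟩ := isReebAt_reebField ha hz
    exact ⟨_, h1, by simp [h2]⟩
  nondegenerate z hz u hu hα h := eq_zero_of_dForm_eq_zero ha hz hu hα h

/-! ### Hamiltonian fields of the coordinate integrals and their brackets -/

theorem hasFDerivAt_coordIntegral (j : Fin (n + 1)) :
    HasFDerivAt (coordIntegral j)
      (2 • (innerSL ℝ (z j)).comp (ContinuousLinearMap.proj (R := ℝ) (φ := fun _ => ℂ) j)) z :=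
  (hasFDerivAt_apply j z).norm_sq

theorem differential_coordIntegral (ha : ∀ j, 0 < a j) (hz : z ∈ carrier (definingMap a))
    (j : Fin (n + 1)) (v : tangent (definingMap a) z) :
    differential (definingMap a) (coordIntegral j) z v = 2 * (conj (z j) * v.1 j).re := by
  rw [(isRegular_definingMap ha).differential_apply hz (hasFDerivAt_coordIntegral j)]
  simp [Complex.inner]
  ring

theorem deriveAlong_coordIntegral (ha : ∀ j, 0 < a j) (hz : z ∈ carrier (definingMap a))
    (j : Fin (n + 1)) {v : Fin (n + 1) → ℂ} (hv : v ∈ tangent (definingMap a) z) :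
    deriveAlong (definingMap a) (coordIntegral j) z v = 2 * (conj (z j) * v j).re := by
  rw [deriveAlong, dif_pos hv, differential_coordIntegral ha hz]

theorem deriveAlong_coordIntegral_reebField (ha : ∀ j, 0 < a j)
    (hz : z ∈ carrier (definingMap a)) (j : Fin (n + 1)) :
    deriveAlong (definingMap a) (coordIntegral j) z (reebField a z) = 0 := by
  rw [deriveAlong_coordIntegral ha hz j (isReebAt_reebField ha hz).1, reebField,
    mul_left_comm, Complex.conj_mul']
  have : 4 * Complex.I / (a j : ℂ) * (‖z j‖ : ℂ) ^ 2
      = ((4 / a j * ‖z j‖ ^ 2 : ℝ) : ℂ) * Complex.I := by push_cast; ring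
  rw [this, Complex.re_ofReal_mul]
  simp

/-- A tangent vector whose contraction with `dα` is `-d f_j`. -/
def coordHamiltonian (a : Fin (n + 1) → ℕ) (j : Fin (n + 1)) (z : Fin (n + 1) → ℂ) :
    Fin (n + 1) → ℂ :=
  Pi.single j (4 * Complex.I / a j * z j)
    - (4 * Complex.I * z j ^ a j / gradientSq a z) • powerGradient a z

theorem coordHamiltonian_mem (ha : ∀ j, 0 < a j) (hz : z ∈ carrier (definingMap a))
    (j : Fin (n + 1)) : coordHamiltonian a j z ∈ tangent (definingMap a) z := by
  have hQ : (gradientSq a z : ℂ) ≠ 0 := by exact_mod_cast (gradientSq_pos ha hz).ne'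
  have hj : (a j : ℂ) ≠ 0 := by exact_mod_cast (ha j).ne'
  rw [mem_tangent_iff ha]
  constructor
  · rw [coordHamiltonian, map_sub, map_smul, weightedForm_weightedPoint_powerGradient ha hz,
      weightedForm_single, weightedPoint, map_div₀, Complex.conj_natCast]
    have : (a j : ℂ) * (conj (z j) / a j) * (4 * Complex.I / (a j : ℂ) * z j)
        = ((4 / a j * ‖z j‖ ^ 2 : ℝ) : ℂ) * Complex.I := by
      push_cast
      rw [← Complex.conj_mul']
      field_simp
    rw [this, Complex.sub_re, Complex.re_ofReal_mul]
    simp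
  · rw [coordHamiltonian, map_sub, map_smul, weightedForm_powerGradient_self,
      weightedForm_single, powerGradient, Complex.conj_conj, ← pow_sub_one_mul (ha j).ne' (z j),
      smul_eq_mul]
    field_simp
    ring

/-- The multiple of `g` is invisible to tangent vectors, leaving only the `j`-th entry. -/
theorem weightedForm_coordHamiltonian (ha : ∀ j, 0 < a j) (j : Fin (n + 1))
    {v : Fin (n + 1) → ℂ} (hv : v ∈ tangent (definingMap a) z) :
    (weightedForm a (coordHamiltonian a j z) v).im = -4 * (conj (z j) * v j).re := by
  have hj : (a j : ℂ) ≠ 0 := by exact_mod_cast (ha j).ne'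
  have h1 : weightedForm a (coordHamiltonian a j z) v = -(4 * (conj (z j) * v j)) * Complex.I := by
    rw [coordHamiltonian, map_sub, map_smulₛₗ, LinearMap.sub_apply, LinearMap.smul_apply,
      ((mem_tangent_iff ha).1 hv).2, ← weightedForm_conj, weightedForm_single]
    simp only [map_mul, map_div₀, Complex.conj_I, Complex.conj_conj, map_natCast, map_ofNat,
      smul_zero, sub_zero]
    field_simp
  rw [h1, Complex.mul_I_im]
  simp

theorem dForm_coordHamiltonian (ha : ∀ j, 0 < a j) (hz : z ∈ carrier (definingMap a))
    (j : Fin (n + 1)) {v : Fin (n + 1) → ℂ} (hv : v ∈ tangent (definingMap a) z) (t : ℝ) :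
    dForm (contactForm a) z (coordHamiltonian a j z - t • reebField a z) v =
      -(2 * (conj (z j) * v j).re) := by
  have h1 := (isReebAt_reebField ha hz).2.2 v hv
  have h2 := weightedForm_coordHamiltonian ha j hv
  have h3 : t • reebField a z = (t : ℂ) • reebField a z := by ext; simp
  rw [dForm_contactForm] at h1 ⊢
  have h4 : (weightedForm a (reebField a z) v).im = 0 := by linarith
  rw [h3, map_sub, map_smulₛₗ, LinearMap.sub_apply, LinearMap.smul_apply, Complex.sub_im, h2]
  simp [h4]
  ring

theorem isHorizontalHamiltonianAt_coordIntegral (hn : 1 ≤ n) (ha : ∀ j, 0 < a j)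
    (hz : z ∈ carrier (definingMap a)) (j : Fin (n + 1)) :
    IsHorizontalHamiltonianAt (definingMap a) (contactForm a) (coordIntegral j) z
      (coordHamiltonian a j z - contactForm a z (coordHamiltonian a j z) • reebField a z) := by
  have hZ := isReebAt_reebField ha hz
  refine ⟨sub_mem (coordHamiltonian_mem ha hz j) (Submodule.smul_mem _ _ hZ.1), ?_, fun w hw => ?_⟩
  · simp [hZ.2.1]
  · rw [(isContactForm_contactForm hn ha).reeb_eq hz hZ, dForm_coordHamiltonian ha hz j hw,
      deriveAlong_coordIntegral_reebField ha hz, deriveAlong_coordIntegral ha hz j hw]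
    ring

/-- The function `conj(z_k ^ a_k) z_j ^ a_j`. -/
def mixedPower (a : Fin (n + 1) → ℕ) (j k : Fin (n + 1)) (z : Fin (n + 1) → ℂ) : ℂ :=
  conj (z k ^ a k) * z j ^ a j

/-- A function on the ambient space that restricts to the bracket `[f_j, f_k]`. -/
def bracketFormula (a : Fin (n + 1) → ℕ) (j k : Fin (n + 1)) (z : Fin (n + 1) → ℂ) : ℝ :=
  8 * (mixedPower a j k z).im / gradientSq a z

/-- The bracket is `-df_j` on the horizontal field of `f_k`. The rotation of the `k`-th coordinate
and the Reeb field preserve `|z_j|`, so only the correction along `g` contributes. -/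
theorem bracketIntegral_eqOn (hn : 1 ≤ n) (ha : ∀ j, 0 < a j) (j k : Fin (n + 1)) :
    Set.EqOn (bracketIntegral a j k) (bracketFormula a j k) (carrier (definingMap a)) := by
  intro z hz
  have hZ := isReebAt_reebField ha hz
  have hk := isHorizontalHamiltonianAt_coordIntegral hn ha hz k
  rw [bracketIntegral, (isContactForm_contactForm hn ha).jacobiBracket_eq hz hZ
    (isHorizontalHamiltonianAt_coordIntegral hn ha hz j) hk
    (deriveAlong_coordIntegral_reebField ha hz j) (deriveAlong_coordIntegral_reebField ha hz k),
    dForm_coordHamiltonian ha hz j hk.1]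
  have h1 := deriveAlong_coordIntegral_reebField ha hz j
  rw [deriveAlong_coordIntegral ha hz j hZ.1] at h1
  have h2 : (conj (z j) * (Pi.single k (4 * Complex.I / a k * z k) : Fin (n + 1) → ℂ) j).re = 0 := by
    by_cases hjk : j = k
    · subst hjk
      rw [Pi.single_eq_same]
      rw [reebField] at h1
      linarith
    · rw [Pi.single_eq_of_ne hjk]
      simp
  have h3 : (conj (z j) * (coordHamiltonian a k z j)).re =
      4 * (mixedPower a j k z).im * (-(gradientSq a z)⁻¹) := by
    rw [coordHamiltonian, Pi.sub_apply, mul_sub, Complex.sub_re, h2, Pi.smul_apply, smul_eq_mul,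
      powerGradient, mixedPower, ← pow_sub_one_mul (ha j).ne' (z j)]
    have : conj (z j) * (4 * Complex.I * z k ^ a k / gradientSq a z * conj (z j ^ (a j - 1)))
        = ((4 * (gradientSq a z)⁻¹ : ℝ) : ℂ) *
          (Complex.I * conj (conj (z k ^ a k) * (z j ^ (a j - 1) * z j))) := by
      simp only [map_mul, Complex.conj_conj]
      push_cast
      ring
    rw [this, Complex.re_ofReal_mul, Complex.I_mul_re, Complex.conj_im]
    ring
  rw [Pi.sub_apply, mul_sub, Complex.sub_re, h3, Pi.smul_apply, Complex.real_smul,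
    mul_left_comm, Complex.re_ofReal_mul, bracketFormula]
  have h4 : (conj (z j) * reebField a z j).re = 0 := by linarith
  rw [h4]
  ring

/-! ### Derivatives in logarithmic coordinates -/

/-- The vector with logarithmic coordinates `ζ_j / a_j` at `z`. -/
def logVector (a : Fin (n + 1) → ℕ) (z ζ : Fin (n + 1) → ℂ) : Fin (n + 1) → ℂ :=
  fun j => ζ j / a j * z j

/-- The curve through `z` with constant logarithmic velocity `ζ_j / a_j`. -/
def logCurve (a : Fin (n + 1) → ℕ) (z ζ : Fin (n + 1) → ℂ) (t : ℝ) : Fin (n + 1) → ℂ :=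
  fun j => Complex.exp (t * (ζ j / a j)) * z j

theorem logCurve_zero (ζ : Fin (n + 1) → ℂ) : logCurve a z ζ 0 = z := by
  ext j
  simp [logCurve]

theorem hasDerivAt_exp_ofReal_mul (c : ℂ) :
    HasDerivAt (fun t : ℝ => Complex.exp (t * c)) c 0 := by
  have h := (((hasDerivAt_id (0 : ℝ)).ofReal_comp).mul_const c).cexp
  simpa using h

theorem hasDerivAt_logCurve (ζ : Fin (n + 1) → ℂ) :
    HasDerivAt (logCurve a z ζ) (logVector a z ζ) 0 :=
  hasDerivAt_pi.2 fun j => (hasDerivAt_exp_ofReal_mul (ζ j / a j)).mul_const (z j)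

theorem mixedPower_logCurve (ha : ∀ j, 0 < a j) (j k : Fin (n + 1)) (ζ : Fin (n + 1) → ℂ)
    (t : ℝ) : mixedPower a j k (logCurve a z ζ t) =
      Complex.exp (t * (ζ j + conj (ζ k))) * mixedPower a j k z := by
  have h : ∀ l, logCurve a z ζ t l ^ a l = Complex.exp (t * ζ l) * z l ^ a l := fun l => by
    have : (a l : ℂ) ≠ 0 := by exact_mod_cast (ha l).ne'
    rw [logCurve, mul_pow, ← Complex.exp_nat_mul]
    congr 2
    field_simp
  rw [mixedPower, h, h, mixedPower, mul_add, Complex.exp_add, map_mul, ← Complex.exp_conj, map_mul,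
    Complex.conj_ofReal]
  ring

theorem gradientSq_logCurve {ζ : Fin (n + 1) → ℂ} (hζ : ∀ j, (ζ j).re = 0) (t : ℝ) :
    gradientSq a (logCurve a z ζ t) = gradientSq a z := by
  refine Finset.sum_congr rfl fun j _ => ?_
  have : ‖Complex.exp (t * (ζ j / a j))‖ = 1 := by
    rw [Complex.norm_exp, Complex.re_ofReal_mul, Complex.div_natCast_re, hζ]
    simp
  rw [logCurve, mul_pow, norm_mul, norm_pow, this, one_pow, one_mul]

theorem contDiff_mixedPower (j k : Fin (n + 1)) : ContDiff ℝ ∞ (mixedPower a j k) := by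
  have h : ∀ j, ContDiff ℝ ∞ fun z : Fin (n + 1) → ℂ => z j ^ a j :=
    fun j => (contDiff_apply ℝ ℂ j).pow _
  exact (Complex.conjCLE.contDiff.comp (h k)).mul (h j)

theorem contDiff_gradientSq : ContDiff ℝ ∞ (gradientSq a) :=
  ContDiff.sum fun j _ => contDiff_const.mul (((contDiff_apply ℝ ℂ j).pow (a j - 1)).norm_sq ℝ)

theorem contDiffOn_bracketFormula (j k : Fin (n + 1)) :
    ContDiffOn ℝ ∞ (bracketFormula a j k) {z | gradientSq a z ≠ 0} :=
  ((contDiff_const.mul (Complex.imCLM.contDiff.comp (contDiff_mixedPower j k))).contDiffOn).div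
    contDiff_gradientSq.contDiffOn fun _ hx => hx

theorem isOpen_gradientSq_ne_zero : IsOpen {z | gradientSq a z ≠ 0} :=
  isOpen_ne_fun contDiff_gradientSq.continuous continuous_const

/-- The curve need not stay in `B`: this is the chain rule for a function on the ambient space. -/
theorem fderiv_apply_logVector {F : Type*} [NormedAddCommGroup F] [NormedSpace ℝ F]
    {f : (Fin (n + 1) → ℂ) → F} (hf : DifferentiableAt ℝ f z)
    {ζ : Fin (n + 1) → ℂ} {d : F} (hd : HasDerivAt (fun t => f (logCurve a z ζ t)) d 0) :
    fderiv ℝ f z (logVector a z ζ) = d := by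
  have h := hf.hasFDerivAt
  rw [← logCurve_zero (a := a) (z := z) ζ] at h
  have h2 := h.comp_hasDerivAt (0 : ℝ) (hasDerivAt_logCurve ζ)
  rw [logCurve_zero] at h2
  exact h2.unique hd

theorem fderiv_mixedPower (ha : ∀ j, 0 < a j) (j k : Fin (n + 1)) (ζ : Fin (n + 1) → ℂ) :
    fderiv ℝ (mixedPower a j k) z (logVector a z ζ) = (ζ j + conj (ζ k)) * mixedPower a j k z := by
  refine fderiv_apply_logVector ((contDiff_mixedPower j k).differentiable (by simp) z) ?_
  simp only [mixedPower_logCurve ha]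
  exact (hasDerivAt_exp_ofReal_mul _).mul_const _

/-- For imaginary `ζ` the curve only rotates phases, so the denominator is constant along it. -/
theorem fderiv_bracketFormula (ha : ∀ j, 0 < a j) (hz : z ∈ carrier (definingMap a))
    (j k : Fin (n + 1)) {ζ : Fin (n + 1) → ℂ} (hζ : ∀ j, (ζ j).re = 0) :
    fderiv ℝ (bracketFormula a j k) z (logVector a z ζ) =
      8 * ((ζ j + conj (ζ k)) * mixedPower a j k z).im / gradientSq a z := by
  have hd : DifferentiableAt ℝ (bracketFormula a j k) z :=
    ((contDiffOn_bracketFormula j k).contDiffAt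
      (isOpen_gradientSq_ne_zero.mem_nhds (gradientSq_pos ha hz).ne')).differentiableAt (by simp)
  refine fderiv_apply_logVector hd ?_
  simp only [bracketFormula, mixedPower_logCurve ha, gradientSq_logCurve hζ]
  exact ((Complex.imCLM.hasFDerivAt.comp_hasDerivAt (0 : ℝ)
    ((hasDerivAt_exp_ofReal_mul (ζ j + conj (ζ k))).mul_const _)).const_mul 8).div_const _

theorem differential_bracketIntegral (hn : 1 ≤ n) (ha : ∀ j, 0 < a j)
    (hz : z ∈ carrier (definingMap a)) (j k : Fin (n + 1)) {ζ : Fin (n + 1) → ℂ}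
    (hζ : ∀ j, (ζ j).re = 0) (hv : logVector a z ζ ∈ tangent (definingMap a) z) :
    differential (definingMap a) (bracketIntegral a j k) z ⟨logVector a z ζ, hv⟩ =
      8 * ((ζ j + conj (ζ k)) * mixedPower a j k z).im / gradientSq a z := by
  have hd : DifferentiableAt ℝ (bracketFormula a j k) z :=
    ((contDiffOn_bracketFormula j k).contDiffAt
      (isOpen_gradientSq_ne_zero.mem_nhds (gradientSq_pos ha hz).ne')).differentiableAt (by simp)
  rw [differential_congr (bracketIntegral_eqOn hn ha j k) hz,
    (isRegular_definingMap ha).differential_apply hz hd.hasFDerivAt,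
    fderiv_bracketFormula ha hz j k hζ]

theorem reebField_eq_logVector : reebField a z = logVector a z fun _ => 4 * Complex.I := rfl

theorem isReebIntegral_of_mem (hn : 1 ≤ n) (ha : ∀ j, 0 < a j) {f : (Fin (n + 1) → ℂ) → ℝ}
    (hf : f ∈ integrals a) : IsReebIntegral (definingMap a) (contactForm a) f := by
  have hreeb : ∀ z ∈ carrier (definingMap a),
      reeb (definingMap a) (contactForm a) z = reebField a z := fun z hz =>
    (isContactForm_contactForm hn ha).reeb_eq hz (isReebAt_reebField ha hz)
  rcases hf with ⟨j, rfl⟩ | ⟨j, k, rfl⟩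
  · refine ⟨fun z hz => ⟨Set.univ, isOpen_univ, trivial, coordIntegral j, ?_, fun _ _ => rfl⟩,
      fun z hz => ?_⟩
    · exact ((contDiff_apply ℝ ℂ j).norm_sq ℝ).contDiffOn
    · rw [hreeb z hz, deriveAlong_coordIntegral_reebField ha hz]
  · refine ⟨fun z hz => ⟨_, isOpen_gradientSq_ne_zero (a := a), (gradientSq_pos ha hz).ne',
      bracketFormula a j k, contDiffOn_bracketFormula j k,
      (bracketIntegral_eqOn hn ha j k).mono Set.inter_subset_left⟩, fun z hz => ?_⟩
    have hZ := (isReebAt_reebField ha hz).1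
    rw [hreeb z hz, deriveAlong, dif_pos hZ]
    rw [reebField_eq_logVector] at hZ
    exact (differential_bracketIntegral hn ha hz j k (by simp) hZ).trans (by simp)

theorem mem_tangent_logVector_iff (ha : ∀ j, 0 < a j) {ζ : Fin (n + 1) → ℂ} :
    logVector a z ζ ∈ tangent (definingMap a) z ↔
      ∑ j, ‖z j‖ ^ 2 / a j * (ζ j).re = 0 ∧ ∑ j, ζ j * z j ^ a j = 0 := by
  rw [mem_tangent_iff ha, weightedForm_weightedPoint ha, weightedForm_powerGradient, Complex.re_sum]
  have h1 : ∀ j, (conj (z j) * logVector a z ζ j).re = ‖z j‖ ^ 2 / a j * (ζ j).re := fun j => by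
    have : conj (z j) * logVector a z ζ j = ((‖z j‖ ^ 2 / a j : ℝ) : ℂ) * ζ j := by
      push_cast
      rw [← Complex.conj_mul', logVector]
      ring
    rw [this, Complex.re_ofReal_mul]
  have h2 : ∀ j, a j * z j ^ (a j - 1) * logVector a z ζ j = ζ j * z j ^ a j := fun j => by
    have : (a j : ℂ) ≠ 0 := by exact_mod_cast (ha j).ne'
    rw [← pow_sub_one_mul (ha j).ne' (z j), logVector]
    field_simp
  simp only [h1, h2]

/-- On the part of the manifold where no coordinate vanishes, two phases can be rotated
independently along the manifold. -/
theorem exists_tangent_logVector (hn : 2 ≤ n) (ha : ∀ j, 0 < a j)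
    (hz : z ∈ carrier (definingMap a)) (h0 : ∀ j, z j ≠ 0) {j k : Fin (n + 1)} (hjk : j ≠ k) :
    ∃ ζ : Fin (n + 1) → ℂ, logVector a z ζ ∈ tangent (definingMap a) z ∧
      (ζ j).re = (ζ k).re ∧ (ζ j).im - (ζ k).im = 1 := by
  obtain ⟨l, hl⟩ : ∃ l, l ∉ ({j, k} : Finset (Fin (n + 1))) := by
    by_contra! h
    have h1 := Finset.card_le_card (s := Finset.univ) (t := {j, k}) fun l _ => h l
    have h2 := Finset.card_le_two (a := j) (b := k)
    simp at h1
    omega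
  simp only [Finset.mem_insert, Finset.mem_singleton, not_or] at hl
  -- Rotate `z_j`; the entry at the third index `l` compensates, so that `∑ ξ_i z_i^{a_i} = 0`.
  set ξ : Fin (n + 1) → ℂ := Pi.single j Complex.I
    + Pi.single l (-(Complex.I * z j ^ a j / z l ^ a l)) with hξ
  have hS : 0 < ∑ j, ‖z j‖ ^ 2 / (a j : ℝ) := by
    refine Finset.sum_pos (fun i _ => ?_) ⟨j, Finset.mem_univ j⟩
    exact div_pos (pow_pos (norm_pos_iff.2 (h0 i)) 2) (Nat.cast_pos.2 (ha i))
  -- Subtracting this weighted mean restores the sphere equation, and `∑ z_i^{a_i} = 0` keeps the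
  -- other equation intact.
  set c : ℝ := (∑ j, ‖z j‖ ^ 2 / a j * (ξ j).re) / ∑ j, ‖z j‖ ^ 2 / (a j : ℝ) with hc
  have hξj : ξ j = Complex.I := by simp [hξ, Pi.single_eq_of_ne (Ne.symm hl.1)]
  have hξk : ξ k = 0 := by
    simp [hξ, Pi.single_eq_of_ne (Ne.symm hl.2), Pi.single_eq_of_ne (Ne.symm hjk)]
  refine ⟨fun i => ξ i - c, (mem_tangent_logVector_iff ha).2 ⟨?_, ?_⟩, ?_, ?_⟩
  · simp only [Complex.sub_re, Complex.ofReal_re, mul_sub, Finset.sum_sub_distrib]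
    rw [← Finset.sum_mul, hc]
    field_simp
    ring
  · simp only [sub_mul, Finset.sum_sub_distrib]
    rw [← Finset.mul_sum, (mem_carrier_iff.1 hz).2, mul_zero, sub_zero]
    have : z l ^ a l ≠ 0 := pow_ne_zero _ (h0 l)
    simp [hξ, add_mul, Finset.sum_add_distrib, Pi.single_apply]
    field_simp
    ring
  · simp [hξj, hξk]
  · simp [hξj, hξk]

/-! ### Density of the genericity conditions -/

theorem mixedPower_ne_zero (h0 : ∀ j, z j ≠ 0) (j k : Fin (n + 1)) : mixedPower a j k z ≠ 0 := by
  simp [mixedPower, h0]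

/-- At a zero of `z_j`, the tangential projection of the `j`-th basis vector still has positive
`j`-th entry, so `Re z_j` has nonzero derivative along `B`. -/
theorem dense_coord_ne_zero (ha : ∀ j, 0 < a j) (j : Fin (n + 1)) :
    Dense {z : carrier (definingMap a) | z.1 j ≠ 0} := by
  intro z
  by_cases hj : z.1 j = 0
  swap
  · exact subset_closure hj
  have h1 : HasStrictFDerivAt (fun z : Fin (n + 1) → ℂ => (z j).re)
      (Complex.reCLM.comp (ContinuousLinearMap.proj (R := ℝ) (φ := fun _ => ℂ) j)) z.1 :=
    ContinuousLinearMap.hasStrictFDerivAt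
      (Complex.reCLM.comp (ContinuousLinearMap.proj (R := ℝ) (φ := fun _ : Fin (n + 1) => ℂ) j))
  have hQ := gradientSq_pos ha z.2
  have hsub : {x : carrier (definingMap a) | (x.1 j).re ≠ 0} ⊆ {x | x.1 j ≠ 0} :=
    fun x hx h => hx (by simp [h])
  refine closure_mono hsub ((isRegular_definingMap ha).mem_closure_ne_zero z h1
    (tangentProj_mem ha z.2 (Pi.single j 1)) ?_)
  -- This matters when `a_j = 1`, where the `j`-th term is `1` even though `z_j = 0`; a nonzero
  -- coordinate `z_k` makes the inequality strict.
  have hlt : a j * ‖z.1 j ^ (a j - 1)‖ ^ 2 < gradientSq a z.1 := by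
    obtain ⟨k, hk⟩ := exists_ne_zero z.2
    refine Finset.single_lt_sum (f := fun j => (a j : ℝ) * ‖z.1 j ^ (a j - 1)‖ ^ 2) (i := j) (j := k)
      (fun h => hk (h ▸ hj)) (Finset.mem_univ _)
      (Finset.mem_univ _) ?_ fun _ _ _ => by positivity
    exact mul_pos (Nat.cast_pos.2 (ha k)) (pow_pos (norm_pos_iff.2 (pow_ne_zero _ hk)) 2)
  have h2 : tangentProj a z.1 (Pi.single j 1) j =
      ((1 - a j * ‖z.1 j ^ (a j - 1)‖ ^ 2 / gradientSq a z.1 : ℝ) : ℂ) := by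
    simp only [tangentProj, weightedForm_single, weightedPoint, hj, powerGradient, Pi.sub_apply,
      Pi.smul_apply, smul_eq_mul, Pi.single_eq_same]
    push_cast
    rw [← Complex.conj_mul', Complex.conj_conj]
    simp
    ring
  have h3 : a j * ‖z.1 j ^ (a j - 1)‖ ^ 2 / gradientSq a z.1 < 1 := (div_lt_one hQ).2 hlt
  simp only [ContinuousLinearMap.comp_apply, ContinuousLinearMap.proj_apply, h2]
  rw [Complex.reCLM_apply, Complex.ofReal_re]
  linarith

instance : BaireSpace (carrier (definingMap a)) := by
  have h : IsClosed (carrier (definingMap a)) :=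
    isClosed_eq contDiff_definingMap.continuous continuous_const
  have := h.completeSpace_coe
  infer_instance

theorem isOpen_forall_coord_ne_zero :
    IsOpen {z : carrier (definingMap a) | ∀ j, z.1 j ≠ 0} := by
  simp only [Set.ofPred_forall]
  exact isOpen_iInter_of_finite fun j =>
    isOpen_ne_fun ((continuous_apply j).comp continuous_subtype_val) continuous_const

theorem dense_forall_coord_ne_zero (ha : ∀ j, 0 < a j) :
    Dense {z : carrier (definingMap a) | ∀ j, z.1 j ≠ 0} := by
  simp only [Set.ofPred_forall]
  refine dense_iInter_of_isOpen (fun j => ?_) fun j => dense_coord_ne_zero ha j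
  exact isOpen_ne_fun ((continuous_apply j).comp continuous_subtype_val) continuous_const

/-- The real part of a nonzero multiple of `mixedPower` is nonzero on a dense set. -/
theorem dense_mixedPower_ne_zero (hn : 2 ≤ n) (ha : ∀ j, 0 < a j) {j k : Fin (n + 1)}
    (hjk : j ≠ k) {c : ℂ} (hc : c ≠ 0) :
    Dense {z : carrier (definingMap a) | (c * mixedPower a j k z.1).re ≠ 0} := by
  -- It suffices to approximate the points without zero coordinates, where phases can be rotated.
  refine dense_closure.1 ((dense_forall_coord_ne_zero ha).mono fun z h0 => ?_)
  by_cases hz : (c * mixedPower a j k z.1).re = 0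
  swap
  · exact subset_closure hz
  obtain ⟨ζ, hv, h1, h2⟩ := exists_tangent_logVector hn ha z.2 h0 hjk
  have hd : HasStrictFDerivAt (mixedPower a j k) (fderiv ℝ (mixedPower a j k) z.1) z.1 :=
    (contDiff_mixedPower j k).contDiffAt.hasStrictFDerivAt (by simp)
  have hs := (Complex.reCLM.hasStrictFDerivAt).comp z.1 (hd.const_mul c)
  refine (isRegular_definingMap ha).mem_closure_ne_zero z hs hv ?_
  have h3 : (c * mixedPower a j k z.1).im ≠ 0 := fun h =>
    mul_ne_zero hc (mixedPower_ne_zero h0 j k) (Complex.ext hz h)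
  have h4 : (ζ j + conj (ζ k)).im = 1 := by simp [← h2, sub_eq_add_neg]
  have h5 : c * ((ζ j + conj (ζ k)) * mixedPower a j k z.1)
      = (ζ j + conj (ζ k)) * (c * mixedPower a j k z.1) := by ring
  simp only [ContinuousLinearMap.comp_apply, smul_apply, smul_eq_mul,
    fderiv_mixedPower ha, h5, Complex.reCLM_apply]
  -- As `Re(cP) = 0`, only the rotation contributes, and the derivative is `-Im(cP)`.
  rw [Complex.mul_re, hz, h4, mul_zero, zero_sub, one_mul]
  exact neg_ne_zero.2 h3

theorem isOpen_mixedPower_ne_zero (j k : Fin (n + 1)) (c : ℂ) :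
    IsOpen {z : carrier (definingMap a) | (c * mixedPower a j k z.1).re ≠ 0} :=
  isOpen_ne_fun (Complex.continuous_re.comp (continuous_const.mul
    ((contDiff_mixedPower j k).continuous.comp continuous_subtype_val))) continuous_const

theorem setOf_forall_re_mixedPower_ne_zero :
    {z : carrier (definingMap a) | ∀ k, k ≠ 0 → (mixedPower a 0 k z.1).re ≠ 0} =
      ⋂ k : {k : Fin (n + 1) // k ≠ 0}, {z | (1 * mixedPower a 0 k.1 z.1).re ≠ 0} := by
  ext z
  simp

theorem isOpen_forall_re_mixedPower_ne_zero :
    IsOpen {z : carrier (definingMap a) | ∀ k, k ≠ 0 → (mixedPower a 0 k z.1).re ≠ 0} := by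
  rw [setOf_forall_re_mixedPower_ne_zero]
  apply isOpen_iInter_of_finite
  intro k
  exact isOpen_mixedPower_ne_zero 0 k.1 1

theorem dense_forall_re_mixedPower_ne_zero (hn : 2 ≤ n) (ha : ∀ j, 0 < a j) :
    Dense {z : carrier (definingMap a) | ∀ k, k ≠ 0 → (mixedPower a 0 k z.1).re ≠ 0} := by
  rw [setOf_forall_re_mixedPower_ne_zero]
  apply dense_iInter_of_isOpen
  · intro k
    exact isOpen_mixedPower_ne_zero 0 k.1 1
  · intro k
    exact dense_mixedPower_ne_zero hn ha k.2.symm one_ne_zero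

/-! ### Independence at generic points -/

/-- At a generic point, a tangent vector annihilated by the differentials of `f_1, …, f_n` and
of `[f_0, f_k]`, `1 ≤ k ≤ n - 2`, is a multiple of the Reeb field. -/
theorem mem_span_reebField (hn : 2 ≤ n) (ha : ∀ j, 0 < a j) (hz : z ∈ carrier (definingMap a))
    (h0 : ∀ j, z j ≠ 0)
    (hre : ∀ k : Fin (n + 1), k ≠ 0 → (k : ℕ) + 1 < n → (mixedPower a 0 k z).re ≠ 0)
    {p q : Fin (n + 1)} (hp : (p : ℕ) + 1 = n) (hq : (q : ℕ) = n)
    (him : (mixedPower a p q z).im ≠ 0) (v : tangent (definingMap a) z)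
    (hf : ∀ j, j ≠ 0 → differential (definingMap a) (coordIntegral j) z v = 0)
    (hb : ∀ k : Fin (n + 1), k ≠ 0 → (k : ℕ) + 1 < n →
      differential (definingMap a) (bracketIntegral a 0 k) z v = 0) :
    ∃ t : ℝ, v.1 = t • reebField a z := by
  have hQ := gradientSq_pos ha hz
  obtain ⟨v, hv⟩ := v
  obtain ⟨ζ, rfl⟩ : ∃ ζ, v = logVector a z ζ := by
    refine ⟨fun j => a j * v j / z j, ?_⟩
    ext j
    have h1 : (a j : ℂ) ≠ 0 := by exact_mod_cast (ha j).ne'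
    have h2 := h0 j
    rw [logVector]
    field_simp
  obtain ⟨h1, h2⟩ := (mem_tangent_logVector_iff ha).1 hv
  have hpos : ∀ j, 0 < ‖z j‖ ^ 2 / (a j : ℝ) := fun i =>
    div_pos (pow_pos (norm_pos_iff.2 (h0 i)) 2) (Nat.cast_pos.2 (ha i))
  have hζ' : ∀ j, j ≠ 0 → (ζ j).re = 0 := by
    intro j hj
    have h3 := hf j hj
    rw [differential_coordIntegral ha hz] at h3
    have h4 : conj (z j) * logVector a z ζ j = ((‖z j‖ ^ 2 / a j : ℝ) : ℂ) * ζ j := by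
      push_cast
      rw [← Complex.conj_mul', logVector]
      ring
    rw [h4, Complex.re_ofReal_mul] at h3
    simpa [(hpos j).ne'] using h3
  have hζ : ∀ j, (ζ j).re = 0 := by
    intro j
    by_cases hj : j = 0
    · subst hj
      rw [Finset.sum_eq_single 0 (fun j _ hj => by simp [hζ' j hj]) (by simp)] at h1
      exact (mul_eq_zero.1 h1).resolve_left (hpos 0).ne'
    · exact hζ' j hj
  have hI : ∀ j, ζ j = ((ζ j).im : ℂ) * Complex.I := fun j => by
    apply Complex.ext <;> simp [hζ]
  have hk : ∀ k : Fin (n + 1), (k : ℕ) + 1 < n → (ζ k).im = (ζ 0).im := by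
    intro k hk
    by_cases hk0 : k = 0
    · rw [hk0]
    have h3 := hb k hk0 hk
    rw [differential_bracketIntegral (by omega) ha hz 0 k hζ hv, div_eq_zero_iff,
      or_iff_left hQ.ne', Complex.mul_im] at h3
    simp only [Complex.add_re, Complex.conj_re, hζ, Complex.add_im, Complex.conj_im] at h3
    -- For imaginary `ζ`, `Im((ζ_0 + conj ζ_k) P) = (Im ζ_0 - Im ζ_k) Re P`.
    have h4 : ((ζ 0).im - (ζ k).im) * (mixedPower a 0 k z).re = 0 := by linarith
    linarith [(mul_eq_zero.1 h4).resolve_right (hre k hk0 hk)]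
  have hpq : p ≠ q := fun h => by rw [h] at hp; omega
  set s := (ζ 0).im with hs
  have h3 : ∑ j, (((ζ j).im - s : ℝ) : ℂ) * z j ^ a j = 0 := by
    have h4 : Complex.I * ∑ j, (((ζ j).im - s : ℝ) : ℂ) * z j ^ a j
        = ∑ j, ζ j * z j ^ a j - s * Complex.I * ∑ j, z j ^ a j := by
      rw [Finset.mul_sum, Finset.mul_sum, ← Finset.sum_sub_distrib]
      refine Finset.sum_congr rfl fun j _ => ?_
      rw [hI j]
      push_cast
      simp
      ring
    rw [h2, (mem_carrier_iff.1 hz).2, mul_zero, sub_zero] at h4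
    exact (mul_eq_zero.1 h4).resolve_left Complex.I_ne_zero
  rw [← Finset.sum_subset (Finset.subset_univ {p, q}), Finset.sum_pair hpq] at h3
  swap
  · intro j _ hj
    simp only [Finset.mem_insert, Finset.mem_singleton, not_or, Fin.ext_iff] at hj
    rw [hk j (by omega), sub_self, Complex.ofReal_zero, zero_mul]
  have hsp : (ζ p).im - s = 0 := by
    -- Multiplying by `conj(z_q^{a_q})` makes the `q`-term real, so the imaginary part isolates the
    -- `p`-term.
    have h4 := congrArg (fun x => (conj (z q ^ a q) * x).im) h3
    have h5 : conj (z q ^ a q) * ((((ζ p).im - s : ℝ) : ℂ) * z p ^ a p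
        + (((ζ q).im - s : ℝ) : ℂ) * z q ^ a q)
        = (((ζ p).im - s : ℝ) : ℂ) * mixedPower a p q z
          + ((((ζ q).im - s) * ‖z q ^ a q‖ ^ 2 : ℝ) : ℂ) := by
      push_cast
      rw [← Complex.conj_mul' (z q ^ a q), mixedPower]
      ring
    simp only [h5, Complex.add_im, Complex.im_ofReal_mul, Complex.ofReal_im, mul_zero, add_zero,
      Complex.zero_im] at h4
    exact (mul_eq_zero.1 h4).resolve_right him
  have hsq : (ζ q).im - s = 0 := by
    rw [hsp, Complex.ofReal_zero, zero_mul, zero_add] at h3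
    exact_mod_cast (mul_eq_zero.1 h3).resolve_right (pow_ne_zero _ (h0 q))
  have hall : ∀ j, (ζ j).im = s := by
    intro j
    by_cases hj : (j : ℕ) + 1 < n
    · exact hk j hj
    · have : j = p ∨ j = q := by
        simp only [Fin.ext_iff]
        omega
      rcases this with rfl | rfl <;> linarith
  -- The Reeb field has all logarithmic coordinates equal to `4i`.
  refine ⟨s / 4, ?_⟩
  ext j
  change ζ j / a j * z j = _
  rw [hI j, hall, Pi.smul_apply, reebField, Complex.real_smul]
  push_cast
  ring

/-- An enumeration of `f_1, …, f_n, [f_0, f_1], [f_0, f_2], …`. -/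
def genericIntegral (a : Fin (n + 1) → ℕ) (i : ℕ) : (Fin (n + 1) → ℂ) → ℝ :=
  if i < n then coordIntegral (Fin.ofNat (n + 1) (i + 1))
  else bracketIntegral a 0 (Fin.ofNat (n + 1) (i - n + 1))

theorem genericIntegral_mem (i : ℕ) : genericIntegral a i ∈ integrals a := by
  by_cases hi : i < n
  · exact Or.inl ⟨_, if_pos hi⟩
  · exact Or.inr ⟨_, _, if_neg hi⟩

theorem genericIntegral_pred {j : Fin (n + 1)} (hj : j ≠ 0) :
    genericIntegral a (j - 1) = coordIntegral j := by
  have hj0 := Fin.val_ne_zero_iff.2 hj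
  have hjn := j.2
  rw [genericIntegral, if_pos (by omega), Nat.sub_add_cancel (by omega), Fin.ofNat_val_eq_self]

theorem genericIntegral_add_pred {k : Fin (n + 1)} (hk : k ≠ 0) :
    genericIntegral a (n + (k - 1)) = bracketIntegral a 0 k := by
  have hk0 := Fin.val_ne_zero_iff.2 hk
  rw [genericIntegral, if_neg (by omega), Nat.add_sub_cancel_left, Nat.sub_add_cancel (by omega),
    Fin.ofNat_val_eq_self]

theorem linearIndependent_genericIntegral (hn : 2 ≤ n) (ha : ∀ j, 0 < a j)
    (hz : z ∈ carrier (definingMap a)) (h0 : ∀ j, z j ≠ 0)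
    (hre : ∀ k : Fin (n + 1), k ≠ 0 → (k : ℕ) + 1 < n → (mixedPower a 0 k z).re ≠ 0)
    {p q : Fin (n + 1)} (hp : (p : ℕ) + 1 = n) (hq : (q : ℕ) = n)
    (him : (mixedPower a p q z).im ≠ 0) {K : ℕ} (hK : K = 2 * n - 2) :
    LinearIndependent ℝ fun i : Fin K => differential (definingMap a) (genericIntegral a i) z := by
  apply linearIndependent_of_finrank_ker_pi_le
  have hker : (LinearMap.pi fun i : Fin K =>
      differential (definingMap a) (genericIntegral a i) z).ker ≤
      Submodule.span ℝ {⟨reebField a z, (isReebAt_reebField ha hz).1⟩} := by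
    intro v hv
    have hv' : ∀ i < K, differential (definingMap a) (genericIntegral a i) z v = 0 :=
      fun i hi => congrFun (LinearMap.mem_ker.1 hv) ⟨i, hi⟩
    obtain ⟨t, ht⟩ := mem_span_reebField hn ha hz h0 hre hp hq him v
      (fun j hj => by
        have := Fin.val_ne_zero_iff.2 hj
        rw [← genericIntegral_pred (a := a) hj]
        exact hv' _ (by omega))
      (fun k hk hkn => by
        have := Fin.val_ne_zero_iff.2 hk
        rw [← genericIntegral_add_pred hk]
        exact hv' _ (by omega))
    exact Submodule.mem_span_singleton.2 ⟨t, Subtype.ext ht.symm⟩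
  have h1 := (Submodule.finrank_mono hker).trans (finrank_span_le_card _)
  have h2 := finrank_tangent ha hz
  rw [Set.toFinset_singleton, Finset.card_singleton] at h1
  rw [Fintype.card_fin]
  omega

/-- The length is a variable `K` so that both index types `Fin (2 * (n - 1) - 0)` and `Fin (2 * n -
2)` are covered. -/
theorem areIndependent_genericIntegral (hn : 1 ≤ n) (ha : ∀ j, 0 < a j) {K : ℕ}
    (hK : K = 2 * n - 2) :
    AreIndependent (definingMap a) fun i : Fin K => genericIntegral a i := by
  obtain hn1 | hn2 : n = 1 ∨ 2 ≤ n := by omega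
  -- For `n = 1` the family is empty; the density arguments need a third coordinate.
  · obtain rfl : K = 0 := by omega
    exact ⟨Set.univ, isOpen_univ, dense_univ, fun z _ => linearIndependent_empty_type⟩
  let p : Fin (n + 1) := ⟨n - 1, by omega⟩
  have hp : (p : ℕ) + 1 = n := Nat.sub_add_cancel hn
  have hpq : p ≠ Fin.last n := fun h => by
    rw [h, Fin.val_last] at hp
    omega
  have hA := isOpen_forall_coord_ne_zero (a := a)
  have hB := isOpen_forall_re_mixedPower_ne_zero (a := a)
  have hd := ((dense_forall_re_mixedPower_ne_zero hn2 ha).inter_of_isOpen_left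
    (dense_mixedPower_ne_zero hn2 ha hpq Complex.I_ne_zero) hB)
  refine ⟨_, hA.inter (hB.inter (isOpen_mixedPower_ne_zero p (Fin.last n) Complex.I)),
    (dense_forall_coord_ne_zero ha).inter_of_isOpen_left hd hA, fun z hz => ?_⟩
  refine linearIndependent_genericIntegral hn2 ha z.2 hz.1 (fun k hk _ => hz.2.1 k hk) hp
    (Fin.val_last n) (fun h => hz.2.2 ?_) hK
  rw [Complex.I_mul_re, h, neg_zero]

end Brieskorn

end

theorem proposition4p2 (n : ℕ) (hn : 1 ≤ n) (a : Fin (n + 1) → ℕ) (ha : ∀ j, 0 < a j) :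
    ContactLevelSet.IsContactForm (Brieskorn.definingMap a) (Brieskorn.contactForm a) (n - 1) ∧
    (∀ z ∈ ContactLevelSet.carrier (Brieskorn.definingMap a),
      ContactLevelSet.IsReebAt (Brieskorn.definingMap a) (Brieskorn.contactForm a) z
        (Brieskorn.reebField a z)) ∧
    ContactLevelSet.IsCompleteNoncommutative (Brieskorn.definingMap a) (Brieskorn.contactForm a)
      (n - 1) 0 (Brieskorn.integrals a) ∧
    ∃ g : Fin (2 * n - 2) → (Fin (n + 1) → ℂ) → ℝ,
      (∀ i, g i ∈ Brieskorn.integrals a) ∧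
      ContactLevelSet.AreIndependent (Brieskorn.definingMap a) g := by
  refine ⟨Brieskorn.isContactForm_contactForm hn ha,
    fun z hz => Brieskorn.isReebAt_reebField ha hz, ⟨Nat.zero_le _,
    fun f hf => Brieskorn.isReebIntegral_of_mem hn ha hf,
    fun i => Brieskorn.genericIntegral a i, fun i => Brieskorn.genericIntegral_mem i,
    Brieskorn.areIndependent_genericIntegral hn ha (by omega),
    fun i j hj => absurd hj (Nat.not_lt_zero _)⟩,
    fun i => Brieskorn.genericIntegral a i, fun i => Brieskorn.genericIntegral_mem i,
    Brieskorn.areIndependent_genericIntegral hn ha rfl⟩
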